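/- **Theorem 3.3 (Worst Case Upper Bound).** Let $p\ge 1$, let $P_\theta$ be a probability measure on $\mathbb R^d$ with finite $p$-th moment, and let $W_p(P,Q)=\inf_{\gamma\in\Gamma(P,Q)}\big(\mathbb E_{(Z,V)\sim\gamma}\|Z-V\|^p\big)^{1/p}$ be the $p$-Wasserstein distance (Euclidean norm, $\Gamma(P,Q)$ the couplings of $P$ and $Q$). For a test dataset $\mathcal D_m$ of $m$ i.i.d. observations, with empirical measure $\hat Q_m$, let $T_m=m^{1/2}W_p(P_\theta,\hat Q_m)$. Let $F_m(t)=\Pr(T_m\le t)$ be the distribution function of $T_m$ under $H_0:\mathcal D_m\sim P_\theta$. For $\alpha\in(0,1)$ let $\lambda_{m,1-\alpha}=\inf\{t\in\mathbb R: F_m(t)\ge 1-\alpha\}$. Assume that the null distribution functions are asymptotically continuous at the critical values: $$\lim_{\varepsilon\downarrow0}\ \limsup_{m\to\infty}\ \big(F_m(\lambda_{m,1-\alpha})-F_m(\lambda_{m,1-\alpha}-\varepsilon)\big)=0$$ (this holds for instance if $\lambda_{m,1-\alpha}\to\lambda_{1-\alpha}\in\mathbb R$ and $F_m$ converges pointwise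 to a function that is continuous at $\lambda_{1-\alpha}$). Let $c_m$ be critical values with $c_m-\lambda_{m,1-\alpha}\to0$ (for instance $c_m=\lambda_{m,1-\alpha}$, or $c_m=\lambda_{1-\alpha}$ if $\lambda_{m,1-\alpha}\to\lambda_{1-\alpha}$), and let $\varrho_m(Q)=\Pr(T_m>c_m)$ for $\mathcal D_m\sim Q$, the power of the Wasserstein test against $Q$. Then: 1. for every sequence of probability measures $Q_m$ on $\mathbb R^d$ with $m^{1/2}W_p(P_\theta,Q_m)\to0$, $\ \limsup_{m\to\infty}\varrho_m(Q_m)\le\alpha$; 2. uniformly over such alternatives: for every sequence $r_m\to0$ in $[0,\infty]$, $\ \limsup_{m\to\infty}\ \sup\{\varrho_m(Q): m^{1/2}W_p(P_\theta,Q)\le r_m\}\le\alpha$, where $Q$ ranges over probability measures on $\mathbb R^d$. In other words, such near-OOD alternatives cannot be detected. -/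

import Mathlib

open MeasureTheory Filter Topology
open scoped ENNReal

/-- The couplings of `P` and `Q`: measures on the product with marginals `P` and `Q`. -/
def couplings {E : Type*} [MeasurableSpace E] (P Q : Measure E) : Set (Measure (E × E)) :=
  {γ | γ.map Prod.fst = P ∧ γ.map Prod.snd = Q}

/-- The `p`-Wasserstein distance
`W_p(P, Q) = inf_γ (∫ ‖z - v‖ ^ p dγ(z, v)) ^ (1 / p)`, with values in `[0, ∞]`. -/
noncomputable def wassersteinDist {E : Type*} [NormedAddCommGroup E] [MeasurableSpace E]
    (p : ℝ) (P Q : Measure E) : ℝ≥0∞ :=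
  ⨅ γ ∈ couplings P Q, (∫⁻ z, ‖z.1 - z.2‖ₑ ^ p ∂γ) ^ (1 / p)

/-- The empirical measure `(1 / m) ∑ i, δ_{x i}` of a sample of size `m`. -/
noncomputable def empiricalMeasure {E : Type*} [MeasurableSpace E] {m : ℕ} (x : Fin m → E) :
    Measure E :=
  (m : ℝ≥0∞)⁻¹ • ∑ i, Measure.dirac (x i)

/-- The law of a test dataset of `m` independent observations from `Q`. -/
noncomputable def sampleLaw {E : Type*} [MeasurableSpace E] (Q : Measure E) (m : ℕ) :
    Measure (Fin m → E) :=
  Measure.pi (fun _ => Q)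

/-- The Wasserstein test statistic `√m * W_p(P, Q̂_m)`, with `Q̂_m` the empirical measure of the
test dataset. (For `m ≥ 1` the distance is finite as soon as `P` has a finite `p`-th moment.) -/
noncomputable def wassersteinStat {E : Type*} [NormedAddCommGroup E] [MeasurableSpace E]
    (p : ℝ) (P : Measure E) {m : ℕ} (x : Fin m → E) : ℝ :=
  √(m : ℝ) * (wassersteinDist p P (empiricalMeasure x)).toReal

/-- The distribution function of the test statistic under the null hypothesis, i.e. when the
test dataset consists of `m` independent observations from `P`. -/
noncomputable def nullCdf {E : Type*} [NormedAddCommGroup E] [MeasurableSpace E]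
    (p : ℝ) (P : Measure E) (m : ℕ) (t : ℝ) : ℝ :=
  (sampleLaw P m).real {x | wassersteinStat p P x ≤ t}

/-- The critical value `λ_{m, 1 - α}`: the `(1 - α)`-quantile of the test statistic under the
null hypothesis. -/
noncomputable def criticalValue {E : Type*} [NormedAddCommGroup E] [MeasurableSpace E]
    (p : ℝ) (P : Measure E) (α : ℝ) (m : ℕ) : ℝ :=
  sInf {t | 1 - α ≤ nullCdf p P m t}

/-- The power against `Q` of the test that rejects the null hypothesis when the statistic
exceeds `c`: the probability of rejection when the `m` observations are drawn from `Q`. -/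
noncomputable def power {E : Type*} [NormedAddCommGroup E] [MeasurableSpace E]
    (p : ℝ) (P : Measure E) (m : ℕ) (c : ℝ) (Q : Measure E) : ℝ≥0∞ :=
  sampleLaw Q m {x | c < wassersteinStat p P x}

/-- Asymptotic continuity of the null distribution functions at the critical values:
`lim_{ε → 0} limsup_m (F_m(λ_m) - F_m(λ_m - ε)) = 0`. Distribution functions are right
continuous, so only the left side is at stake. -/
def NullCdfAsympContinuous {E : Type*} [NormedAddCommGroup E] [MeasurableSpace E]
    (p : ℝ) (P : Measure E) (α : ℝ) : Prop :=
  ∀ η > 0, ∃ ε > 0, ∀ᶠ m : ℕ in atTop,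
    nullCdf p P m (criticalValue p P α m) - nullCdf p P m (criticalValue p P α m - ε) ≤ η

/-! Draw `m` independent pairs from a nearly optimal coupling `γ` of `P` and `Q`, so that the first
coordinates form a sample from `P` and the second a sample from `Q`. By gluing, the two statistics
differ by at most `√m` times the cost of matching the samples index by index
(`wassersteinStat_le_add`). The expected `p`-th power of that cost is the transport cost of `γ`, so
Markov's inequality gives, for every `δ > 0`, power against `Q` at `c` ≤ power against `P` at `c -
δ`, plus `(κ / δ) ^ p`, where `κ` bounds the scaled cost of `γ` (`power_le_add_of_coupling`).

With `δ` fixed and `κ → 0` the last term vanishes; asymptotic continuity of the null distribution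
functions bounds the price of the shift by `δ`. Nothing depends on `Q` except through `κ`, hence the
uniformity. -/

section Coupling

/-! ### Couplings, empirical measures and laws of samples. -/

variable {E : Type*} [MeasurableSpace E]

lemma isProbabilityMeasure_of_mem_couplings {P Q : Measure E} [IsProbabilityMeasure P]
    {γ : Measure (E × E)} (hγ : γ ∈ couplings P Q) : IsProbabilityMeasure γ := by
  have : IsProbabilityMeasure (γ.map Prod.fst) := hγ.1.symm ▸ inferInstance
  exact Measure.isProbabilityMeasure_of_map Prod.fst

lemma prod_mem_couplings (P Q : Measure E) [IsProbabilityMeasure P] [IsProbabilityMeasure Q] :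
    P.prod Q ∈ couplings P Q := by
  constructor
  · simp [Measure.map_fst_prod]
  · simp [Measure.map_snd_prod]

instance isProbabilityMeasure_empiricalMeasure {m : ℕ} [NeZero m] (x : Fin m → E) :
    IsProbabilityMeasure (empiricalMeasure x) := by
  constructor
  simp only [empiricalMeasure, Measure.smul_apply, Measure.finsetSum_apply, measure_univ,
    Finset.sum_const, Finset.card_univ, Fintype.card_fin, nsmul_eq_mul, mul_one, smul_eq_mul]
  exact ENNReal.inv_mul_cancel (by simpa using NeZero.ne m) (by simp)

lemma lintegral_empiricalMeasure {m : ℕ} (x : Fin m → E) {f : E → ℝ≥0∞} (hf : Measurable f) :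
    ∫⁻ z, f z ∂(empiricalMeasure x) = (m : ℝ≥0∞)⁻¹ * ∑ i, f (x i) := by
  simp [empiricalMeasure, lintegral_smul_measure, lintegral_finsetSum_measure,
    lintegral_dirac' _ hf]

/-- This moves couplings to the index space `Fin m`, where samples with repeated points need no
special treatment. -/
lemma map_empiricalMeasure_id {m : ℕ} (x : Fin m → E) :
    (empiricalMeasure (id : Fin m → Fin m)).map x = empiricalMeasure x := by
  have hx : Measurable x := measurable_of_countable x
  ext s hs
  simp [Measure.map_apply hx hs, empiricalMeasure, Measure.dirac_apply' _ (hx hs),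
    Measure.dirac_apply' _ hs]
  rfl

instance isProbabilityMeasure_sampleLaw (Q : Measure E) [IsProbabilityMeasure Q] (m : ℕ) :
    IsProbabilityMeasure (sampleLaw Q m) := by
  unfold sampleLaw
  infer_instance

lemma measurePreserving_sampleLaw_fst {P Q : Measure E} [IsProbabilityMeasure P]
    [IsProbabilityMeasure Q] {γ : Measure (E × E)} (hγ : γ ∈ couplings P Q) (m : ℕ) :
    MeasurePreserving (fun w : Fin m → E × E => fun i => (w i).1)
      (sampleLaw γ m) (sampleLaw P m) := by
  have := isProbabilityMeasure_of_mem_couplings hγ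
  exact measurePreserving_pi (fun _ => γ) (fun _ => P) fun _ => ⟨measurable_fst, hγ.1⟩

lemma measurePreserving_sampleLaw_snd {P Q : Measure E} [IsProbabilityMeasure P]
    [IsProbabilityMeasure Q] {γ : Measure (E × E)} (hγ : γ ∈ couplings P Q) (m : ℕ) :
    MeasurePreserving (fun w : Fin m → E × E => fun i => (w i).2)
      (sampleLaw γ m) (sampleLaw Q m) := by
  have := isProbabilityMeasure_of_mem_couplings hγ
  exact measurePreserving_pi (fun _ => γ) (fun _ => Q) fun _ => ⟨measurable_snd, hγ.2⟩

end Coupling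

/-- The `p`-th power of the cost of matching two samples of size `m` index by index. -/
noncomputable def matchingCost {E : Type*} [NormedAddCommGroup E] (p : ℝ) {m : ℕ}
    (x y : Fin m → E) : ℝ≥0∞ :=
  (m : ℝ≥0∞)⁻¹ * ∑ i, ‖x i - y i‖ₑ ^ p

/-! ### Matching cost and monotonicity of the null distribution function. -/

section

variable {E : Type*} [NormedAddCommGroup E] {p : ℝ}

lemma matchingCost_ne_top (hp : 1 ≤ p) {m : ℕ} [NeZero m] (x y : Fin m → E) :
    matchingCost p x y ≠ ∞ := by
  refine ENNReal.mul_ne_top (by simpa using NeZero.ne m) (ENNReal.sum_ne_top.2 fun i _ => ?_)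
  exact ENNReal.rpow_ne_top_of_nonneg (by linarith) (by simp)

lemma continuous_matchingCost {m : ℕ} [NeZero m] (x : Fin m → E) :
    Continuous (matchingCost p x) := by
  refine ENNReal.continuous_const_mul (by simpa using NeZero.ne m) |>.comp ?_
  refine continuous_finsetSum _ fun i _ => ?_
  exact ENNReal.continuous_rpow_const.comp (by fun_prop)

lemma matchingCost_comm {m : ℕ} (x y : Fin m → E) : matchingCost p x y = matchingCost p y x := by
  simp only [matchingCost, enorm_sub_rev]

lemma nullCdf_mono [MeasurableSpace E] {P : Measure E} [IsProbabilityMeasure P] {m : ℕ} :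
    Monotone (nullCdf p P m) := fun _ _ hst =>
  measureReal_mono fun _ hx => le_trans hx hst

end

/-! ### Stability of the statistic under a change of sample. -/

section Stat

open scoped ProbabilityTheory

variable {E : Type*} [NormedAddCommGroup E] [MeasurableSpace E] [BorelSpace E]
  [SecondCountableTopology E] {p : ℝ}

/-- A coupling of `P` with the empirical measure of `x` is glued to the matching of `x` with `y`. -/
lemma wassersteinDist_empiricalMeasure_le [CompleteSpace E] (hp : 1 ≤ p) (P : Measure E)
    {m : ℕ} [NeZero m] (x y : Fin m → E) :
    wassersteinDist p P (empiricalMeasure y) ≤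
      wassersteinDist p P (empiricalMeasure x) + matchingCost p x y ^ (1 / p) := by
  simp only [wassersteinDist, ENNReal.iInf_add]
  refine le_iInf₂ fun γ hγ => ?_
  set U : Measure (Fin m) := empiricalMeasure id with hU
  have hx : Measurable x := measurable_of_countable x
  have hy : Measurable y := measurable_of_countable y
  have hfst : (γ.map Prod.swap).fst = empiricalMeasure x := by
    rw [Measure.fst, Measure.map_map measurable_fst measurable_swap]
    exact hγ.2
  have : IsProbabilityMeasure (γ.map Prod.swap).fst := hfst ▸ inferInstance
  have : IsProbabilityMeasure (γ.map Prod.swap) := by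
    rw [Measure.fst] at this
    exact Measure.isProbabilityMeasure_of_map Prod.fst
  -- The swap puts the sample point first, so that `κ` is the conditional law of the `P`-coordinate
  -- given it.
  set κ := (γ.map Prod.swap).condKernel with hκ
  have hdis : (empiricalMeasure x) ⊗ₘ κ = γ.map Prod.swap := by
    rw [← hfst, hκ, Measure.disintegrate]
  -- Choose an index `i` uniformly, then `z` from `κ (x i)`: the pair `(z, x i)` has law `γ`, while
  -- `(z, y i)` couples `P` with the empirical measure of `y`.
  set ρ : Measure (Fin m × E) := U ⊗ₘ (κ.comap x hx) with hρ
  have hmx : Measurable fun w : Fin m × E => (w.2, x w.1) := by fun_prop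
  have hmy : Measurable fun w : Fin m × E => (w.2, y w.1) := by fun_prop
  have hglue : ρ.map (fun w => (w.2, x w.1)) = γ := by
    have hγ' : γ = ((empiricalMeasure x) ⊗ₘ κ).map Prod.swap := by
      rw [hdis, Measure.map_map measurable_swap measurable_swap]
      simp
    rw [hγ']
    ext s hs
    rw [Measure.map_apply hmx hs, Measure.map_apply measurable_swap hs,
      Measure.compProd_apply (hmx hs), Measure.compProd_apply (measurable_swap hs),
      ← map_empiricalMeasure_id x, lintegral_map _ hx]
    · rfl
    · exact ProbabilityTheory.Kernel.measurable_kernel_prodMk_left (measurable_swap hs)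
  have hρfst : ρ.map Prod.fst = U := by
    have := Measure.fst_compProd U (κ.comap x hx)
    rwa [Measure.fst] at this
  have hcoup : ρ.map (fun w => (w.2, y w.1)) ∈ couplings P (empiricalMeasure y) := by
    constructor
    · rw [Measure.map_map measurable_fst hmy, ← hγ.1, ← hglue,
        Measure.map_map measurable_fst hmx]
      rfl
    · rw [Measure.map_map measurable_snd hmy, ← map_empiricalMeasure_id y, ← hU, ← hρfst,
        Measure.map_map hy measurable_fst]
      rfl
  refine (iInf₂_le _ hcoup).trans ?_
  have hcost : Measurable fun z : E × E => ‖z.1 - z.2‖ₑ ^ p := by fun_prop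
  have hγcost : ∫⁻ z, ‖z.1 - z.2‖ₑ ^ p ∂γ = ∫⁻ w, ‖w.2 - x w.1‖ₑ ^ p ∂ρ := by
    rw [← hglue, lintegral_map hcost hmx]
  have hmatch : matchingCost p x y = ∫⁻ w, ‖x w.1 - y w.1‖ₑ ^ p ∂ρ := by
    have hf : Measurable fun i : Fin m => ‖x i - y i‖ₑ ^ p := measurable_of_countable _
    rw [← lintegral_map (f := fun i : Fin m => ‖x i - y i‖ₑ ^ p) hf measurable_fst, hρfst, hU,
      lintegral_empiricalMeasure _ hf]
    rfl
  rw [lintegral_map hcost hmy, hγcost, hmatch]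
  have hm1 : Measurable fun w : Fin m × E => ‖w.2 - x w.1‖ₑ := by fun_prop
  have hm2 : Measurable fun w : Fin m × E => ‖x w.1 - y w.1‖ₑ := by fun_prop
  -- Minkowski's inequality in `L^p(ρ)`, applied to `z - y i = (z - x i) + (x i - y i)`.
  refine le_trans ?_ (ENNReal.lintegral_Lp_add_le hm1.aemeasurable hm2.aemeasurable hp)
  refine ENNReal.rpow_le_rpow (lintegral_mono fun w => ?_) (by positivity)
  refine ENNReal.rpow_le_rpow ?_ (by linarith)
  calc ‖w.2 - y w.1‖ₑ = ‖(w.2 - x w.1) + (x w.1 - y w.1)‖ₑ := by congr 1; abel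
    _ ≤ _ := enorm_add_le _ _

/-- The product coupling has finite cost. Finiteness matters because the statistic uses `toReal`,
which sends `∞` to `0` and would break the triangle inequality. -/
lemma wassersteinDist_empiricalMeasure_ne_top (hp : 1 ≤ p) {P : Measure E}
    [IsProbabilityMeasure P] (hP : ∫⁻ z, ‖z‖ₑ ^ p ∂P < ∞) {m : ℕ} [NeZero m] (x : Fin m → E) :
    wassersteinDist p P (empiricalMeasure x) ≠ ∞ := by
  refine ne_top_of_le_ne_top ?_ (iInf₂_le _ (prod_mem_couplings P (empiricalMeasure x)))
  have hp0 : 0 ≤ p := by linarith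
  have hp1 : 0 ≤ 1 / p := by positivity
  set ρ := P.prod (empiricalMeasure x)
  have hf : Measurable fun z : E => ‖z‖ₑ ^ p := by fun_prop
  have h1 : ∫⁻ z, ‖z.1‖ₑ ^ p ∂ρ ≠ ∞ := by
    rw [← lintegral_map (f := fun z : E => ‖z‖ₑ ^ p) hf measurable_fst,
      (prod_mem_couplings P (empiricalMeasure x)).1]
    exact hP.ne
  have h2 : ∫⁻ z, ‖z.2‖ₑ ^ p ∂ρ ≠ ∞ := by
    rw [← lintegral_map (f := fun z : E => ‖z‖ₑ ^ p) hf measurable_snd,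
      (prod_mem_couplings P (empiricalMeasure x)).2, lintegral_empiricalMeasure _ hf]
    simpa [matchingCost] using matchingCost_ne_top hp x 0
  have hm1 : Measurable fun z : E × E => ‖z.1‖ₑ := by fun_prop
  have hm2 : Measurable fun z : E × E => ‖z.2‖ₑ := by fun_prop
  refine ne_top_of_le_ne_top (ENNReal.add_ne_top.2 ⟨ENNReal.rpow_ne_top_of_nonneg hp1 h1,
    ENNReal.rpow_ne_top_of_nonneg hp1 h2⟩)
    (le_trans ?_ (ENNReal.lintegral_Lp_add_le hm1.aemeasurable hm2.aemeasurable hp))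
  refine ENNReal.rpow_le_rpow (lintegral_mono fun w => ?_) hp1
  exact ENNReal.rpow_le_rpow enorm_sub_le hp0

lemma wassersteinStat_le_add [CompleteSpace E] (hp : 1 ≤ p) {P : Measure E}
    [IsProbabilityMeasure P] (hP : ∫⁻ z, ‖z‖ₑ ^ p ∂P < ∞) {m : ℕ} [NeZero m] (x y : Fin m → E) :
    wassersteinStat p P y ≤
      wassersteinStat p P x + √(m : ℝ) * (matchingCost p x y ^ (1 / p)).toReal := by
  have hm : matchingCost p x y ^ (1 / p) ≠ ∞ :=
    ENNReal.rpow_ne_top_of_nonneg (by positivity) (matchingCost_ne_top hp x y)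
  have hx := wassersteinDist_empiricalMeasure_ne_top hp hP x
  rw [wassersteinStat, wassersteinStat, ← mul_add, ← ENNReal.toReal_add hx hm]
  exact mul_le_mul_of_nonneg_left (ENNReal.toReal_mono (ENNReal.add_ne_top.2 ⟨hx, hm⟩)
    (wassersteinDist_empiricalMeasure_le hp P x y)) (Real.sqrt_nonneg _)

/-- Serves to make the statistic measurable; the stability bound is used in both directions. -/
lemma continuous_wassersteinStat [CompleteSpace E] (hp : 1 ≤ p) {P : Measure E}
    [IsProbabilityMeasure P] (hP : ∫⁻ z, ‖z‖ₑ ^ p ∂P < ∞) {m : ℕ} [NeZero m] :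
    Continuous fun x : Fin m → E => wassersteinStat p P x := by
  rw [continuous_iff_continuousAt]
  intro x
  rw [ContinuousAt, tendsto_iff_dist_tendsto_zero]
  refine squeeze_zero (g := fun y => √(m : ℝ) * (matchingCost p x y ^ (1 / p)).toReal)
    (fun _ => dist_nonneg) (fun y => ?_) ?_
  · have h1 := wassersteinStat_le_add hp hP x y
    have h2 := wassersteinStat_le_add hp hP y x
    rw [matchingCost_comm y x] at h2
    rw [Real.dist_eq, abs_le]
    constructor <;> linarith
  · have h0 : matchingCost p x x = 0 := by
      simp [matchingCost, ENNReal.zero_rpow_of_pos (show 0 < p by linarith)]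
    have h1 : Tendsto (fun y => matchingCost p x y ^ (1 / p)) (𝓝 x)
        (𝓝 (matchingCost p x x ^ (1 / p))) :=
      (ENNReal.continuous_rpow_const.comp (continuous_matchingCost x)).tendsto x
    rw [h0, ENNReal.zero_rpow_of_pos (show 0 < 1 / p by positivity)] at h1
    have h2 := ((ENNReal.tendsto_toReal ENNReal.zero_ne_top).comp h1).const_mul √(m : ℝ)
    simpa using h2

lemma measurable_wassersteinStat [CompleteSpace E] (hp : 1 ≤ p) {P : Measure E}
    [IsProbabilityMeasure P] (hP : ∫⁻ z, ‖z‖ₑ ^ p ∂P < ∞) {m : ℕ} [NeZero m] :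
    Measurable fun x : Fin m → E => wassersteinStat p P x :=
  (continuous_wassersteinStat hp hP).measurable

/-! ### Comparison of the powers against `P` and `Q`. -/

lemma lintegral_matchingCost {γ : Measure (E × E)} [IsProbabilityMeasure γ] (m : ℕ) [NeZero m] :
    ∫⁻ w, matchingCost p (fun i => (w i).1) (fun i => (w i).2) ∂(sampleLaw γ m) =
      ∫⁻ z, ‖z.1 - z.2‖ₑ ^ p ∂γ := by
  have hf : Measurable fun z : E × E => ‖z.1 - z.2‖ₑ ^ p := by fun_prop
  simp only [matchingCost]
  have hg (i : Fin m) : Measurable fun w : Fin m → E × E => ‖(w i).1 - (w i).2‖ₑ ^ p :=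
    hf.comp (measurable_pi_apply i)
  rw [lintegral_const_mul _ (Finset.measurable_fun_sum _ fun i _ => hg i),
    lintegral_finsetSum _ fun i _ => hg i]
  have hi (i : Fin m) : ∫⁻ w : Fin m → E × E, ‖(w i).1 - (w i).2‖ₑ ^ p ∂(sampleLaw γ m) =
      ∫⁻ z, ‖z.1 - z.2‖ₑ ^ p ∂γ :=
    (measurePreserving_eval (fun _ : Fin m => γ) i).lintegral_comp hf
  simp only [hi, Finset.sum_const, Finset.card_univ, Fintype.card_fin, nsmul_eq_mul]
  rw [← mul_assoc, ENNReal.inv_mul_cancel (by simpa using NeZero.ne m) (by simp), one_mul]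

/-- The power against `Q` is controlled by the power against `P` at a smaller threshold and by the
transport cost between `P` and `Q`. -/
lemma power_le_add_of_coupling [CompleteSpace E] (hp : 1 ≤ p) {P Q : Measure E}
    [IsProbabilityMeasure P] [IsProbabilityMeasure Q] (hP : ∫⁻ z, ‖z‖ₑ ^ p ∂P < ∞)
    {γ : Measure (E × E)} (hγ : γ ∈ couplings P Q) {m : ℕ} [NeZero m] {c δ κ : ℝ} (hδ : 0 < δ)
    (hκ : ENNReal.ofReal √(m : ℝ) * (∫⁻ z, ‖z.1 - z.2‖ₑ ^ p ∂γ) ^ (1 / p) ≤ ENNReal.ofReal κ) :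
    power p P m c Q ≤ power p P m (c - δ) P + ENNReal.ofReal (κ / δ) ^ p := by
  have := isProbabilityMeasure_of_mem_couplings hγ
  have hp0 : 0 < p := by linarith
  have hT := measurable_wassersteinStat hp hP (m := m)
  set M : (Fin m → E × E) → ℝ≥0∞ :=
    fun w => matchingCost p (fun i => (w i).1) (fun i => (w i).2) with hM
  -- Chosen so that `M w < ε` forces `√m * M w ^ (1 / p) ≤ δ`.
  set ε : ℝ≥0∞ := ENNReal.ofReal (δ / √(m : ℝ)) ^ p with hε
  have hm0 : 0 < √(m : ℝ) := Real.sqrt_pos.2 (by exact_mod_cast NeZero.pos m)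
  have hm1 : ENNReal.ofReal √(m : ℝ) ≠ 0 := by simpa using hm0
  have hmark : sampleLaw γ m {w | ε ≤ M w} ≤ ENNReal.ofReal (κ / δ) ^ p := by
    have hMm : Measurable M := by
      simp only [hM, matchingCost]
      fun_prop
    have hε0 : ε ≠ 0 := (ENNReal.rpow_pos (by simpa using div_pos hδ hm0) (by simp)).ne'
    have hε1 : ε ≠ ∞ := ENNReal.rpow_ne_top_of_nonneg hp0.le (by simp)
    -- Markov's inequality; the factor `√m` in `ε` turns the transport cost into the scaled cost
    -- bounded by `κ`.
    refine (meas_ge_le_lintegral_div hMm.aemeasurable hε0 hε1).trans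
      (ENNReal.div_le_of_le_mul ?_)
    rw [lintegral_matchingCost, hε, ← ENNReal.mul_rpow_of_nonneg _ _ hp0.le,
      ← ENNReal.ofReal_mul' (by positivity), div_mul_div_cancel₀ hδ.ne',
      ← ENNReal.rpow_inv_le_iff hp0, ← one_div, ENNReal.ofReal_div_of_pos hm0,
      ENNReal.le_div_iff_mul_le (by simp [hm1]) (by simp), mul_comm]
    exact hκ
  calc power p P m c Q
      = sampleLaw γ m {w | c < wassersteinStat p P fun i => (w i).2} :=
        ((measurePreserving_sampleLaw_snd hγ m).measure_preimage
          (measurableSet_lt measurable_const hT).nullMeasurableSet).symm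
    _ ≤ sampleLaw γ m ({w | c - δ < wassersteinStat p P fun i => (w i).1} ∪ {w | ε ≤ M w}) := by
        refine measure_mono fun w hw => ?_
        by_contra hcon
        simp only [Set.mem_union, Set.mem_ofPred_eq, not_or, not_lt, not_le] at hcon hw
        have h1 := wassersteinStat_le_add hp hP (fun i => (w i).1) (fun i => (w i).2)
        have h2 : (M w ^ (1 / p)).toReal ≤ δ / √(m : ℝ) := by
          refine ENNReal.toReal_le_of_le_ofReal (by positivity) ?_
          calc M w ^ (1 / p) ≤ ε ^ (1 / p) := ENNReal.rpow_le_rpow hcon.2.le (by positivity)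
            _ = _ := by rw [hε, one_div, ENNReal.rpow_rpow_inv hp0.ne']
        have h3 := mul_le_mul_of_nonneg_left h2 hm0.le
        rw [mul_div_cancel₀ _ hm0.ne'] at h3
        linarith [hcon.1]
    _ ≤ sampleLaw γ m {w | c - δ < wassersteinStat p P fun i => (w i).1} +
          sampleLaw γ m {w | ε ≤ M w} := measure_union_le _ _
    _ ≤ _ := by
        refine add_le_add (le_of_eq ?_) hmark
        exact (measurePreserving_sampleLaw_fst hγ m).measure_preimage
          (measurableSet_lt measurable_const hT).nullMeasurableSet

/-! ### Null distribution function, its quantile, and the limit. -/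

lemma power_self_eq [CompleteSpace E] (hp : 1 ≤ p) {P : Measure E} [IsProbabilityMeasure P]
    (hP : ∫⁻ z, ‖z‖ₑ ^ p ∂P < ∞) {m : ℕ} [NeZero m] (t : ℝ) :
    power p P m t P = ENNReal.ofReal (1 - nullCdf p P m t) := by
  have hs : MeasurableSet {x : Fin m → E | wassersteinStat p P x ≤ t} :=
    measurableSet_le (measurable_wassersteinStat hp hP) measurable_const
  rw [power, nullCdf, ← probReal_compl_eq_one_sub hs, ofReal_measureReal]
  congr 1
  ext x
  simp

lemma nullCdf_eq_cdf [CompleteSpace E] (hp : 1 ≤ p) {P : Measure E} [IsProbabilityMeasure P]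
    (hP : ∫⁻ z, ‖z‖ₑ ^ p ∂P < ∞) {m : ℕ} [NeZero m] (t : ℝ) :
    nullCdf p P m t =
      ProbabilityTheory.cdf ((sampleLaw P m).map fun x => wassersteinStat p P x) t := by
  have hT := measurable_wassersteinStat hp hP (m := m)
  have : IsProbabilityMeasure ((sampleLaw P m).map fun x => wassersteinStat p P x) :=
    Measure.isProbabilityMeasure_map hT.aemeasurable
  rw [ProbabilityTheory.cdf_eq_real, map_measureReal_apply hT measurableSet_Iic]
  rfl

/-- By right continuity, the infimum defining the critical value is attained. -/
lemma one_sub_le_nullCdf_criticalValue [CompleteSpace E] (hp : 1 ≤ p) {P : Measure E}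
    [IsProbabilityMeasure P] (hP : ∫⁻ z, ‖z‖ₑ ^ p ∂P < ∞) {m : ℕ} [NeZero m] {α : ℝ}
    (hα : 0 < α) : 1 - α ≤ nullCdf p P m (criticalValue p P α m) := by
  set F := ProbabilityTheory.cdf ((sampleLaw P m).map fun x => wassersteinStat p P x)
  have hF : nullCdf p P m = F := funext (nullCdf_eq_cdf hp hP)
  have hne : {t | 1 - α ≤ nullCdf p P m t}.Nonempty := by
    have := (ProbabilityTheory.tendsto_cdf_atTop
      ((sampleLaw P m).map fun x => wassersteinStat p P x)).eventually
        (eventually_ge_nhds (show 1 - α < 1 by linarith))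
    obtain ⟨t, ht⟩ := this.exists
    exact ⟨t, by rw [hF]; exact ht⟩
  have hlim : Tendsto F (𝓝[>] (criticalValue p P α m)) (𝓝 (F (criticalValue p P α m))) :=
    ((F.right_continuous _).mono Set.Ioi_subset_Ici_self).tendsto
  rw [hF]
  refine ge_of_tendsto hlim (eventually_mem_nhdsWithin.mono fun t ht => ?_)
  obtain ⟨s, hs, hst⟩ := exists_lt_of_csInf_lt hne ht
  rw [← hF]
  exact le_trans hs (nullCdf_mono hst.le)

/-- The asymptotic level `α` carries over uniformly to alternatives whose scaled Wasserstein
distance to `P` vanishes. -/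
theorem limsup_iSup_power_le [CompleteSpace E] (hp : 1 ≤ p) {P : Measure E}
    [IsProbabilityMeasure P] (hP : ∫⁻ z, ‖z‖ₑ ^ p ∂P < ∞) {α : ℝ} (hα : 0 < α)
    (hcont : NullCdfAsympContinuous p P α) {c : ℕ → ℝ}
    (hc : Tendsto (fun m => c m - criticalValue p P α m) atTop (𝓝 0))
    {r : ℕ → ℝ≥0∞} (hr : Tendsto r atTop (𝓝 0)) :
    limsup (fun m : ℕ => ⨆ (Q : ProbabilityMeasure E)
      (_ : ENNReal.ofReal √(m : ℝ) * wassersteinDist p P (Q : Measure E) ≤ r m),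
      power p P m (c m) (Q : Measure E)) atTop ≤ ENNReal.ofReal α := by
  have hp0 : 0 < p := by linarith
  refine ENNReal.le_of_forall_pos_le_add fun η hη _ => ?_
  obtain ⟨ε, hε, hev⟩ := hcont (η / 2) (by positivity)
  obtain ⟨τ, hτ, hτη⟩ : ∃ τ : ℝ, 0 < τ ∧ ENNReal.ofReal τ ^ p ≤ ENNReal.ofReal (η / 2) := by
    refine ⟨(η / 2 : ℝ) ^ p⁻¹, by positivity, le_of_eq ?_⟩
    rw [ENNReal.ofReal_rpow_of_pos (by positivity), Real.rpow_inv_rpow (by positivity) hp0.ne']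
  -- Half of `ε` absorbs `c m - criticalValue p P α m`, the other half the shift from the coupling.
  set δ := ε / 2 with hδ
  have hδ0 : 0 < δ := by positivity
  have hκ : 0 < τ * δ := by positivity
  refine limsup_le_of_le ?_ ?_
  · isBoundedDefault
  filter_upwards [hev, hc.eventually (lt_mem_nhds (show -δ < 0 by linarith)),
    hr.eventually (gt_mem_nhds (show (0 : ℝ≥0∞) < ENNReal.ofReal (τ * δ) by simpa using hκ)),
    eventually_ne_atTop 0] with m hm hcm hrm hm0
  have : NeZero m := ⟨hm0⟩
  refine iSup₂_le fun Q hQ => ?_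
  obtain ⟨γ, hγ, hcost⟩ : ∃ γ ∈ couplings P (Q : Measure E), ENNReal.ofReal √(m : ℝ) *
      (∫⁻ z, ‖z.1 - z.2‖ₑ ^ p ∂γ) ^ (1 / p) ≤ ENNReal.ofReal (τ * δ) := by
    -- The infimum need not be attained, but the strict inequality `r m < τ * δ` leaves room for a
    -- coupling.
    by_contra! hcon
    refine (hQ.trans_lt hrm).not_ge ?_
    rw [wassersteinDist, ENNReal.mul_iInf_of_ne (by simpa using NeZero.pos m) (by simp)]
    refine le_iInf fun γ => ?_
    by_cases hγ : γ ∈ couplings P (Q : Measure E)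
    · simpa [hγ] using (hcon γ hγ).le
    · have hm1 : ENNReal.ofReal √(m : ℝ) ≠ 0 := by simpa using NeZero.pos m
      simp only [hγ, iInf_false]
      rw [ENNReal.mul_top hm1]
      exact le_top
  refine (power_le_add_of_coupling hp hP hγ hδ0 hcost).trans ?_
  rw [mul_div_cancel_right₀ _ hδ0.ne', power_self_eq hp hP]
  have h1 := one_sub_le_nullCdf_criticalValue hp hP (m := m) hα
  have h2 : nullCdf p P m (criticalValue p P α m - ε) ≤ nullCdf p P m (c m - δ) :=
    nullCdf_mono (by linarith)
  -- With `λ` the critical value and `F` the null distribution function, `F (c m - δ) ≥ F (λ - ε) ≥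
  -- F λ - η / 2 ≥ 1 - α - η / 2`.
  calc _ ≤ ENNReal.ofReal (α + η / 2) + ENNReal.ofReal (η / 2) :=
        add_le_add (ENNReal.ofReal_le_ofReal (by linarith)) hτη
    _ = ENNReal.ofReal α + η := by
        rw [← ENNReal.ofReal_add (by positivity) (by positivity), add_assoc, add_halves,
          ENNReal.ofReal_add hα.le (by positivity), ENNReal.ofReal_coe_nnreal]

end Stat

theorem theorem3p3 {d : ℕ} {p : ℝ} (hp : 1 ≤ p)
    (P : Measure (EuclideanSpace ℝ (Fin d))) [IsProbabilityMeasure P]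
    (hPmoment : ∫⁻ x, ‖x‖ₑ ^ p ∂P < ∞)
    {α : ℝ} (hα₀ : 0 < α) (hα₁ : α < 1)
    (hcont : NullCdfAsympContinuous p P α)
    (c : ℕ → ℝ) (hc : Tendsto (fun m => c m - criticalValue p P α m) atTop (𝓝 0)) :
    (∀ Q : ℕ → ProbabilityMeasure (EuclideanSpace ℝ (Fin d)),
      Tendsto (fun m : ℕ => ENNReal.ofReal √(m : ℝ) *
        wassersteinDist p P (Q m : Measure (EuclideanSpace ℝ (Fin d)))) atTop (𝓝 0) →
      limsup (fun m : ℕ => power p P m (c m) (Q m : Measure (EuclideanSpace ℝ (Fin d)))) atTop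
        ≤ ENNReal.ofReal α) ∧
    (∀ r : ℕ → ℝ≥0∞, Tendsto r atTop (𝓝 0) →
      limsup (fun m : ℕ => ⨆ (Q : ProbabilityMeasure (EuclideanSpace ℝ (Fin d)))
          (_ : ENNReal.ofReal √(m : ℝ) *
            wassersteinDist p P (Q : Measure (EuclideanSpace ℝ (Fin d))) ≤ r m),
          power p P m (c m) (Q : Measure (EuclideanSpace ℝ (Fin d)))) atTop
        ≤ ENNReal.ofReal α) := by
  refine ⟨fun Q hQ => ?_, fun r hr => limsup_iSup_power_le hp hPmoment hα₀ hcont hc hr⟩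
  -- The uniform bound is applied with `r m` equal to the scaled distance of `Q m` itself.
  refine le_trans (limsup_le_limsup (Eventually.of_forall fun m => ?_))
    (limsup_iSup_power_le hp hPmoment hα₀ hcont hc hQ)
  exact le_iSup₂ (f := fun (Q' : ProbabilityMeasure (EuclideanSpace ℝ (Fin d)))
    (_ : ENNReal.ofReal √(m : ℝ) * wassersteinDist p P (Q' : Measure _) ≤
      ENNReal.ofReal √(m : ℝ) * wassersteinDist p P (Q m : Measure _)) =>
    power p P m (c m) (Q' : Measure _)) (Q m) le_rfl
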